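/- Let $H$ be a separable complex Hilbert space and $L(H)$ the algebra of bounded linear operators on $H$. Let $A_W$ be the Wiener algebra of functions $f(t)=\sum_{n\ge0}f_nt^n$ on the closed unit disc $\overline{\mathbb D}$ with $\sum_n|f_n|<\infty$. For $T\in L(H)$ let $\mathcal A_{T,\mathbb R}$ (respectively $\mathcal A^0_{T,\mathbb R}$) be the set of all $f\in A_W$ with real Taylor coefficients $f_n$ for which $\sum_{n\ge0}|f_n|T^{*n}T^n$ converges in the strong operator topology (respectively in the operator norm). For a function $f$ that is analytic in the open unit disc $\mathbb D$, with Taylor coefficients $f_n$, write $f(T^*,T)=\sum_{n\ge0}f_nT^{*n}T^n$ whenever this series converges in the strong operator topology; $f(T^*,T)\ge0$ means that the series converges in this topology and that its sum is a positive semidefinite operator. Let $\hat T\in L(H)$ have spectrum $\sigma(\hat T)\subset\overline{\mathbb D}$, and let $\gamma(t)=\alpha(t)\tilde\gamma(t)$ for $t\in\mathbb D$, where $\alpha\in\mathcal A_{\hat T,\mathbb R}$, and $\tilde\gamma\in\mathcal A^0_{\hat T,\mathbb R}$ satisfies $\tilde\gamma(t)>0$ for every $t\in[0,1]$. If $\gamma(\hat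 T^*,\hat T)\ge0$, then $\hat T$ is similar to an operator $T\in L(H)$ (that is, $T=V\hat TV^{-1}$ for some bounded invertible operator $V$ on $H$) such that $\alpha(T^*,T)\ge0$. -/

import Mathlib

open Filter Topology

noncomputable section

/-- The `n`-th Taylor coefficient of `f` at the origin. -/
def taylorCoeff (f : ℂ → ℂ) (n : ℕ) : ℂ :=
  iteratedDeriv n f 0 / (n.factorial : ℂ)

/-- The Wiener algebra `A_W`: the functions whose Taylor coefficients at the origin are absolutely
summable and which are the sum of their Taylor series. Such a function extends continuously to the
closed unit disc, so it is regarded as a function there; its values outside the closed unit disc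
play no role. -/
def WienerAlgebra : Set (ℂ → ℂ) :=
  {f | Summable (fun n => ‖taylorCoeff f n‖) ∧
    ∀ z ∈ Metric.closedBall (0 : ℂ) 1, HasSum (fun n => taylorCoeff f n * z ^ n) (f z)}

section Operators

variable {H : Type*} [NormedAddCommGroup H] [InnerProductSpace ℂ H] [CompleteSpace H]

/-- The partial sum `∑_{n < N} c_n T^{*n} T^n`. -/
def hereditaryPartialSum (c : ℕ → ℂ) (T : H →L[ℂ] H) (N : ℕ) : H →L[ℂ] H :=
  ∑ n ∈ Finset.range N, c n • ((ContinuousLinearMap.adjoint T) ^ n * T ^ n)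

/-- The series `∑ c_n T^{*n} T^n` converges to the bounded operator `A` in the strong operator
topology. -/
def HasHereditarySumSOT (c : ℕ → ℂ) (T A : H →L[ℂ] H) : Prop :=
  ∀ x : H, Tendsto (fun N => hereditaryPartialSum c T N x) atTop (𝓝 (A x))

/-- The series `∑ c_n T^{*n} T^n` converges to `A` in the operator norm. -/
def HasHereditarySumNorm (c : ℕ → ℂ) (T A : H →L[ℂ] H) : Prop :=
  Tendsto (hereditaryPartialSum c T) atTop (𝓝 A)

/-- `𝒜_T`: the functions `f` in the Wiener algebra for which `∑ |f_n| T^{*n} T^n` converges in the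
strong operator topology. -/
def algA (T : H →L[ℂ] H) : Set (ℂ → ℂ) :=
  {f | f ∈ WienerAlgebra ∧
    ∃ A : H →L[ℂ] H, HasHereditarySumSOT (fun n => (‖taylorCoeff f n‖ : ℂ)) T A}

/-- `𝒜_T^0`: the functions `f` in the Wiener algebra for which `∑ |f_n| T^{*n} T^n` converges in
the operator norm. -/
def algAZero (T : H →L[ℂ] H) : Set (ℂ → ℂ) :=
  {f | f ∈ WienerAlgebra ∧
    ∃ A : H →L[ℂ] H, HasHereditarySumNorm (fun n => (‖taylorCoeff f n‖ : ℂ)) T A}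

/-- `𝒜_{T,ℝ}`: the functions in `𝒜_T` with real Taylor coefficients. -/
def algAReal (T : H →L[ℂ] H) : Set (ℂ → ℂ) :=
  {f | f ∈ algA T ∧ ∀ n, (taylorCoeff f n).im = 0}

/-- `𝒜_{T,ℝ}^0`: the functions in `𝒜_T^0` with real Taylor coefficients. -/
def algAZeroReal (T : H →L[ℂ] H) : Set (ℂ → ℂ) :=
  {f | f ∈ algAZero T ∧ ∀ n, (taylorCoeff f n).im = 0}

/-- `f(T^*,T) ≥ 0`: the series `∑ f_n T^{*n} T^n` converges in the strong operator topology, and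
its sum is a positive (semidefinite) operator. -/
def HereditaryNonneg (f : ℂ → ℂ) (T : H →L[ℂ] H) : Prop :=
  ∃ A : H →L[ℂ] H, HasHereditarySumSOT (taylorCoeff f) T A ∧ A.IsPositive

/-- `S` and `T` are similar: `T = V S V⁻¹` for some bounded invertible operator `V`. -/
def SimilarOperators (S T : H →L[ℂ] H) : Prop :=
  ∃ V : H ≃L[ℂ] H, T = (V : H →L[ℂ] H) ∘L S ∘L (V.symm : H →L[ℂ] H)

end Operators

end

/-! ### Multipliers for real polynomials positive on [0, 1] -/

noncomputable section

open Polynomial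

/-! Write the quadratic form of `f(T^*,T)` as `q_f(x) = ∑ f_n ‖T^n x‖²`. Forms compose under
multiplication: `q_{fg}(x) = ∑ f_n q_g(T^n x)` (`hasSum_hereditaryForm_mul`). Suppose `h` has
nonnegative coefficients and `q_{hγ̃}` for `T̂` is coercive. Then `q_{hγ̃}(x) = ‖V x‖²` with `V`
bounded and invertible, and for `T = V T̂ V⁻¹` the form of `α` at `V x` is `∑ α_n q_{hγ̃}(T̂^n x) =
q_{αhγ̃}(x) = ∑ h_n q_γ(T̂^n x) ≥ 0`.

To find `h`, split `γ̃ = p + (δ + r)`. Here `p` is a Taylor polynomial minus a small `δ > 0`, still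
positive on [0, 1], and `r` is a tail with `|q_r| ≤ (δ/2)‖x‖²`, which is where norm convergence is
needed. As `p > 0` on [0, 1], some `h` with nonnegative coefficients, `h_0 > 0` and radius of
convergence above one makes `hp` have nonnegative coefficients (`exists_isPositiveMultiplier`).
Since `σ(T̂)` lies in the closed disc, `q_h` is bounded. Thus `q_{hp} ≥ 0`, while `q_{h(δ+r)}(x) ≥
h_0 (δ/2)‖x‖²`. -/

/-- A power series with nonnegative coefficients, positive constant term and radius of
convergence greater than one whose product with `p` has nonnegative coefficients. -/
def IsPositiveMultiplier (p : ℝ[X]) (h : PowerSeries ℝ) : Prop :=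
  (∀ n, 0 ≤ PowerSeries.coeff n h) ∧ 0 < PowerSeries.coeff 0 h ∧
    (∃ R : ℝ, 1 < R ∧ Summable fun n => PowerSeries.coeff n h * R ^ n) ∧
    ∀ n, 0 ≤ PowerSeries.coeff n (h * (p : PowerSeries ℝ))

theorem PowerSeries.coeff_mul_nonneg {f g : PowerSeries ℝ}
    (hf : ∀ n, 0 ≤ PowerSeries.coeff n f) (hg : ∀ n, 0 ≤ PowerSeries.coeff n g) (n : ℕ) :
    0 ≤ PowerSeries.coeff n (f * g) := by
  rw [PowerSeries.coeff_mul]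
  exact Finset.sum_nonneg fun i _ => mul_nonneg (hf _) (hg _)

theorem Polynomial.coeff_mul_nonneg {f g : ℝ[X]}
    (hf : ∀ n, 0 ≤ f.coeff n) (hg : ∀ n, 0 ≤ g.coeff n) (n : ℕ) : 0 ≤ (f * g).coeff n := by
  rw [Polynomial.coeff_mul]
  exact Finset.sum_nonneg fun i _ => mul_nonneg (hf _) (hg _)

theorem PowerSeries.summable_coeff_mul_pow {f g : PowerSeries ℝ} {R : ℝ}
    (hfs : Summable fun n => PowerSeries.coeff n f * R ^ n)
    (hgs : Summable fun n => PowerSeries.coeff n g * R ^ n) :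
    Summable fun n => PowerSeries.coeff n (f * g) * R ^ n := by
  have := (summable_norm_sum_mul_antidiagonal_of_summable_norm hfs.norm hgs.norm).of_norm
  refine this.congr fun n => ?_
  rw [PowerSeries.coeff_mul, Finset.sum_mul]
  refine Finset.sum_congr rfl fun ij hij => ?_
  rw [← Finset.HasAntidiagonal.mem_antidiagonal.1 hij, pow_add]
  ring

/-- Multiplicativity reduces the construction of multipliers to irreducible factors. -/
theorem IsPositiveMultiplier.mul {p q : ℝ[X]} {f g : PowerSeries ℝ}
    (hf : IsPositiveMultiplier p f) (hg : IsPositiveMultiplier q g) :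
    IsPositiveMultiplier (p * q) (f * g) := by
  obtain ⟨hf1, hf2, ⟨R, hR, hfR⟩, hf4⟩ := hf
  obtain ⟨hg1, hg2, ⟨S, hS, hgS⟩, hg4⟩ := hg
  have shrink : ∀ {k : PowerSeries ℝ} {r s : ℝ}, (∀ n, 0 ≤ PowerSeries.coeff n k) → 0 ≤ r →
      r ≤ s → (Summable fun n => PowerSeries.coeff n k * s ^ n) →
      Summable fun n => PowerSeries.coeff n k * r ^ n := fun hk hr hrs hs =>
    Summable.of_nonneg_of_le (fun n => mul_nonneg (hk n) (pow_nonneg hr n))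
      (fun n => mul_le_mul_of_nonneg_left (pow_le_pow_left₀ hr hrs n) (hk n)) hs
  refine ⟨PowerSeries.coeff_mul_nonneg hf1 hg1, by simpa using mul_pos hf2 hg2,
    ⟨min R S, lt_min hR hS, ?_⟩, fun n => ?_⟩
  · have h0 : 0 ≤ min R S := le_min (by linarith) (by linarith)
    exact PowerSeries.summable_coeff_mul_pow (shrink hf1 h0 (min_le_left _ _) hfR)
      (shrink hg1 h0 (min_le_right _ _) hgS)
  · have : f * g * ((p * q : ℝ[X]) : PowerSeries ℝ) =
        (f * (p : PowerSeries ℝ)) * (g * (q : PowerSeries ℝ)) := by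
      rw [Polynomial.coe_mul]; ring
    rw [this]
    exact PowerSeries.coeff_mul_nonneg hf4 hg4 n

theorem isPositiveMultiplier_coe {p h : ℝ[X]} (h0 : ∀ n, 0 ≤ h.coeff n) (h1 : 0 < h.coeff 0)
    (h2 : ∀ n, 0 ≤ (h * p).coeff n) : IsPositiveMultiplier p (h : PowerSeries ℝ) := by
  refine ⟨fun n => by simpa using h0 n, by simpa [Polynomial.coeff_coe] using h1,
    ⟨2, one_lt_two, ?_⟩, fun n => ?_⟩
  · refine summable_of_ne_finset_zero (s := h.support) fun n hn => ?_
    rw [Polynomial.coeff_coe, Polynomial.notMem_support_iff.1 hn, zero_mul]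
  · rw [← Polynomial.coe_mul, Polynomial.coeff_coe]
    exact h2 n

theorem isPositiveMultiplier_one {p : ℝ[X]} (hp : ∀ n, 0 ≤ p.coeff n) :
    IsPositiveMultiplier p 1 := by
  have := isPositiveMultiplier_coe (p := p) (h := 1)
    (fun n => by rw [Polynomial.coeff_one]; split_ifs <;> norm_num) (by simp) (by simpa using hp)
  simpa using this

theorem coeff_quadratic_nonneg {A B C : ℝ} (hA : 0 ≤ A) (hB : 0 ≤ B) (hC : 0 ≤ C) (n : ℕ) :
    0 ≤ (Polynomial.C A * X ^ 2 + Polynomial.C B * X + Polynomial.C C : ℝ[X]).coeff n := by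
  simp only [Polynomial.coeff_add, Polynomial.coeff_C_mul, Polynomial.coeff_X_pow,
    Polynomial.coeff_X, Polynomial.coeff_C]
  split_ifs <;> simp <;> positivity

/-- The substitution `t ↦ t ^ 2` in `q(t) q(-t)` doubles the ratio `(2D + B) / (2D)`. -/
theorem exists_polynomial_multiplier_quadratic (n : ℕ) :
    ∀ A B C D : ℝ, 0 < A → 0 < C → 0 < D → A * C = D ^ 2 → 2 * D ≤ 2 ^ n * (2 * D + B) →
    ∃ h : ℝ[X], (∀ k, 0 ≤ h.coeff k) ∧ 0 < h.coeff 0 ∧ ∀ k, 0 ≤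
      (h * (Polynomial.C A * X ^ 2 + Polynomial.C B * X + Polynomial.C C)).coeff k := by
  induction n with
  | zero =>
    intro A B C D hA hC _ _ hB
    refine ⟨1, fun n => by rw [Polynomial.coeff_one]; split_ifs <;> norm_num, by simp, ?_⟩
    rw [one_mul]
    exact coeff_quadratic_nonneg hA.le (by linarith) hC.le
  | succ n ih =>
    intro A B C D hA hC hD hAC hB
    rcases le_or_gt 0 B with hB0 | hB0
    · refine ⟨1, fun n => by rw [Polynomial.coeff_one]; split_ifs <;> norm_num, by simp, ?_⟩
      rw [one_mul]
      exact coeff_quadratic_nonneg hA.le hB0 hC.le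
    have hs : 0 < 2 * D + B := by
      have : 0 < 2 ^ (n + 1) * (2 * D + B) := by linarith
      exact pos_of_mul_pos_right this (by positivity)
    -- With `D² = AC`, `(At² - Bt + C)(At² + Bt + C) = A²t⁴ + (2D² - B²)t² + C²`. In `t²` this is
    -- again a quadratic, with the argument of its roots doubled; iteration ends once the middle
    -- coefficient is nonnegative. As `B < 0`, `2D - B ≥ 2D`, which yields the bound with exponent
    -- `n`.
    obtain ⟨h, h0, h1, h2⟩ := ih (A ^ 2) (2 * D ^ 2 - B ^ 2) (C ^ 2) (D ^ 2) (by positivity)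
      (by positivity) (by positivity) (by rw [← hAC]; ring) (by
        have e : 2 * D ^ 2 + (2 * D ^ 2 - B ^ 2) = (2 * D + B) * (2 * D - B) := by ring
        have e1 : (2 * D + B) * (2 * D) ≤ (2 * D + B) * (2 * D - B) :=
          mul_le_mul_of_nonneg_left (by linarith) hs.le
        rw [e]
        calc 2 * D ^ 2 = D * (2 * D) := by ring
          _ ≤ D * (2 ^ (n + 1) * (2 * D + B)) := mul_le_mul_of_nonneg_left hB hD.le
          _ = 2 ^ n * ((2 * D + B) * (2 * D)) := by ring
          _ ≤ _ := mul_le_mul_of_nonneg_left e1 (by positivity))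
    have nonneg_expand : ∀ f : ℝ[X], (∀ k, 0 ≤ f.coeff k) →
        ∀ k, 0 ≤ (Polynomial.expand ℝ 2 f).coeff k := fun f hf k => by
      rw [Polynomial.coeff_expand two_pos]
      split_ifs
      exacts [hf _, le_rfl]
    refine ⟨Polynomial.expand ℝ 2 h *
      (Polynomial.C A * X ^ 2 + Polynomial.C (-B) * X + Polynomial.C C),
      Polynomial.coeff_mul_nonneg (nonneg_expand h h0)
        (coeff_quadratic_nonneg hA.le (by linarith) hC.le), ?_, fun k => ?_⟩
    · rw [Polynomial.mul_coeff_zero, Polynomial.coeff_expand two_pos]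
      simpa using mul_pos h1 hC
    · suffices e : Polynomial.expand ℝ 2 h *
          (Polynomial.C A * X ^ 2 + Polynomial.C (-B) * X + Polynomial.C C) *
          (Polynomial.C A * X ^ 2 + Polynomial.C B * X + Polynomial.C C) =
          Polynomial.expand ℝ 2 (h * (Polynomial.C (A ^ 2) * X ^ 2 +
            Polynomial.C (2 * D ^ 2 - B ^ 2) * X + Polynomial.C (C ^ 2))) by
        rw [e]
        exact nonneg_expand _ h2 k
      rw [map_mul, mul_assoc]
      congr 1
      simp only [map_add, map_mul, map_pow, Polynomial.expand_C, Polynomial.expand_X, map_sub,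
        map_neg, map_ofNat, ← hAC, map_mul]
      ring

/-- A negative discriminant says `2√(AC) + B > 0`, so finitely many doublings suffice. -/
theorem exists_isPositiveMultiplier_quadratic {A B C : ℝ} (hA : 0 < A) (hd : B ^ 2 < 4 * A * C) :
    ∃ h, IsPositiveMultiplier (Polynomial.C A * X ^ 2 + Polynomial.C B * X + Polynomial.C C) h := by
  have hAC : 0 < A * C := by nlinarith [sq_nonneg B]
  have hC : 0 < C := pos_of_mul_pos_right hAC hA.le
  have hD : 0 < √(A * C) := Real.sqrt_pos.2 hAC
  have hD2 : √(A * C) ^ 2 = A * C := Real.sq_sqrt hAC.le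
  have hs : 0 < 2 * √(A * C) + B := by
    have := abs_lt_of_sq_lt_sq (a := B) (b := 2 * √(A * C)) (by rw [mul_pow, hD2]; linarith)
      (by positivity)
    linarith [(abs_lt.1 this).1]
  obtain ⟨n, hn⟩ := pow_unbounded_of_one_lt (2 * √(A * C) / (2 * √(A * C) + B)) one_lt_two
  obtain ⟨h, h0, h1, h2⟩ := exists_polynomial_multiplier_quadratic n A B C _ hA hC hD hD2.symm
    ((div_lt_iff₀ hs).1 hn).le
  exact ⟨_, isPositiveMultiplier_coe h0 h1 h2⟩

/-- For negative slope the polynomial is `b(1 - ct)` with `0 < c < 1`, because its root `1/c`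
exceeds 1. The geometric series of `ct` has radius `1/c > 1` and turns it into the constant `b`. -/
theorem exists_isPositiveMultiplier_linear {a b : ℝ} (ha : a ≠ 0)
    (hroot : ∀ t ∈ Set.Icc (0 : ℝ) 1, a * t + b ≠ 0) (hb : 0 < b) :
    ∃ h, IsPositiveMultiplier (Polynomial.C a * X + Polynomial.C b) h := by
  rcases le_or_gt 0 a with ha0 | ha0
  · refine ⟨1, isPositiveMultiplier_one fun n => ?_⟩
    simpa using coeff_quadratic_nonneg le_rfl ha0 hb.le n
  have hab : -a < b := by
    by_contra! hle
    exact hroot (b / -a) ⟨div_nonneg hb.le (by linarith), (div_le_one (by linarith)).2 hle⟩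
      (by field_simp; ring)
  set c := -a / b with hc
  have hc0 : 0 < c := div_pos (by linarith) hb
  have hc1 : c < 1 := (div_lt_one hb).2 hab
  have hacb : a = -(c * b) := by rw [hc]; field_simp
  obtain ⟨R, hR1, hR2⟩ := exists_between ((one_lt_inv₀ hc0).2 hc1)
  refine ⟨PowerSeries.mk fun n => c ^ n, fun n => by rw [PowerSeries.coeff_mk]; positivity,
    by simp, ⟨R, hR1, ?_⟩, fun n => ?_⟩
  · simp only [PowerSeries.coeff_mk, ← mul_pow]
    refine summable_geometric_of_lt_one (by positivity) ?_
    calc c * R < c * c⁻¹ := mul_lt_mul_of_pos_left hR2 hc0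
      _ = 1 := mul_inv_cancel₀ hc0.ne'
  · have : (PowerSeries.mk fun n => c ^ n) *
        ((Polynomial.C a * X + Polynomial.C b : ℝ[X]) : PowerSeries ℝ) = PowerSeries.C b := by
      ext n
      rw [Polynomial.coe_add, Polynomial.coe_mul, Polynomial.coe_C, Polynomial.coe_C,
        Polynomial.coe_X, mul_add, ← mul_assoc, map_add, PowerSeries.coeff_C]
      cases n with
      | zero => simp
      | succ n =>
        rw [PowerSeries.coeff_succ_mul_X, PowerSeries.coeff_mul_C, PowerSeries.coeff_mul_C,
          PowerSeries.coeff_mk, PowerSeries.coeff_mk, hacb]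
        simp only [Nat.add_eq_zero_iff, one_ne_zero, and_false, if_false]
        ring
    rw [this, PowerSeries.coeff_C]
    split_ifs
    exacts [hb.le, le_rfl]

theorem exists_isPositiveMultiplier_of_irreducible {p : ℝ[X]} (hp : Irreducible p)
    (hroot : ∀ t ∈ Set.Icc (0 : ℝ) 1, p.eval t ≠ 0) (h0 : 0 < p.eval 0) :
    ∃ h, IsPositiveMultiplier p h := by
  have hdeg : p.natDegree ≤ 2 := Polynomial.natDegree_le_of_degree_le hp.degree_le_two
  have hform : p = Polynomial.C (p.coeff 2) * X ^ 2 + Polynomial.C (p.coeff 1) * X +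
      Polynomial.C (p.coeff 0) := Polynomial.eq_quadratic_of_degree_le_two
        (Polynomial.natDegree_le_iff_degree_le.1 hdeg)
  have heval : ∀ t, p.eval t = p.coeff 2 * t ^ 2 + p.coeff 1 * t + p.coeff 0 := fun t => by
    conv_lhs => rw [hform]
    simp
  rw [heval] at h0
  simp only [ne_eq, OfNat.ofNat_ne_zero, not_false_eq_true, zero_pow, mul_zero, zero_add] at h0
  by_cases h2 : p.coeff 2 = 0
  · by_cases h1 : p.coeff 1 = 0
    · refine ⟨1, isPositiveMultiplier_one fun n => ?_⟩
      rw [hform, h1, h2]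
      simpa using coeff_quadratic_nonneg le_rfl le_rfl h0.le n
    · obtain ⟨h, hh⟩ := exists_isPositiveMultiplier_linear h1
        (fun t ht => by simpa [heval, h2] using hroot t ht) h0
      refine ⟨h, ?_⟩
      rw [hform, h2]
      simpa using hh
  have hndeg : p.natDegree = 2 := le_antisymm hdeg (Polynomial.le_natDegree_of_ne_zero h2)
  have hnoroot : ∀ t, p.eval t ≠ 0 := fun t ht => by
    have h1 : p.natDegree = 1 := Polynomial.natDegree_eq_of_degree_eq_some
      (Polynomial.degree_eq_one_of_irreducible_of_root hp ht)
    omega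
  have hd : p.coeff 1 ^ 2 < 4 * p.coeff 2 * p.coeff 0 := by
    by_contra! hle
    have hdis : 0 ≤ discrim (p.coeff 2) (p.coeff 1) (p.coeff 0) := by
      rw [discrim]; linarith
    obtain ⟨x, hx⟩ := exists_quadratic_eq_zero h2
      ⟨_, (Real.mul_self_sqrt hdis).symm⟩
    exact hnoroot x (by rw [heval]; linarith [hx])
  have hA : 0 < p.coeff 2 := by
    have : 0 < p.coeff 2 * p.coeff 0 := by nlinarith [sq_nonneg (p.coeff 1)]
    exact pos_of_mul_pos_left this h0.le
  obtain ⟨h, hh⟩ := exists_isPositiveMultiplier_quadratic hA hd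
  exact ⟨h, by rw [hform]; exact hh⟩

/-- Prime factors are fixed only up to sign, so the induction carries both alternatives; the sign is
settled at the end. -/
theorem exists_isPositiveMultiplier_or_neg (p : ℝ[X]) (hp0 : p ≠ 0) :
    (∀ t ∈ Set.Icc (0 : ℝ) 1, p.eval t ≠ 0) →
    ∃ h, IsPositiveMultiplier p h ∨ IsPositiveMultiplier (-p) h := by
  have key : ∀ q : ℝ[X], Irreducible q ∨ IsUnit q → (∀ t ∈ Set.Icc (0 : ℝ) 1, q.eval t ≠ 0) →
      ∃ h, IsPositiveMultiplier q h ∨ IsPositiveMultiplier (-q) h := by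
    rintro q (hq | hq) hroot
    · rcases lt_or_gt_of_ne (hroot 0 (by simp)) with h0 | h0
      · obtain ⟨h, hh⟩ := exists_isPositiveMultiplier_of_irreducible (p := -q)
          ((Associated.refl q).neg_right.irreducible hq)
          (fun t ht => by simpa using hroot t ht) (by simpa using h0)
        exact ⟨h, Or.inr hh⟩
      · obtain ⟨h, hh⟩ := exists_isPositiveMultiplier_of_irreducible hq hroot h0
        exact ⟨h, Or.inl hh⟩
    · obtain ⟨c, _, rfl⟩ := Polynomial.isUnit_iff.1 hq
      refine ⟨1, (le_total 0 c).imp (fun hc => isPositiveMultiplier_one fun n => ?_)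
        fun hc => isPositiveMultiplier_one fun n => ?_⟩
      · rw [Polynomial.coeff_C]; split_ifs <;> simp [hc]
      · rw [Polynomial.coeff_neg, Polynomial.coeff_C]; split_ifs <;> simp [hc]
  induction p using UniqueFactorizationMonoid.induction_on_prime with
  | h₁ => exact absurd rfl hp0
  | h₂ u hu => exact key u (Or.inr hu)
  | h₃ a q ha hq ih =>
    intro hroot
    obtain ⟨f, hf⟩ := key q (Or.inl hq.irreducible)
      (fun t ht h => hroot t ht (by rw [Polynomial.eval_mul, h, zero_mul]))
    obtain ⟨g, hg⟩ := ih ha (fun t ht h => hroot t ht (by rw [Polynomial.eval_mul, h, mul_zero]))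
    refine ⟨f * g, ?_⟩
    rcases hf with hf | hf <;> rcases hg with hg | hg
    · exact Or.inl (hf.mul hg)
    · exact Or.inr (by simpa using hf.mul hg)
    · exact Or.inr (by simpa using hf.mul hg)
    · exact Or.inl (by simpa using hf.mul hg)

theorem exists_isPositiveMultiplier {p : ℝ[X]} (hp : ∀ t ∈ Set.Icc (0 : ℝ) 1, 0 < p.eval t) :
    ∃ h, IsPositiveMultiplier p h := by
  have h0 := hp 0 (by simp)
  obtain ⟨h, hh | hh⟩ := exists_isPositiveMultiplier_or_neg p
    (by rintro rfl; simp at h0) (fun t ht => (hp t ht).ne')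
  · exact ⟨h, hh⟩
  -- The constant coefficient of `h * (-p)` would be `-h_0 p(0) < 0`.
  · exfalso
    have h1 := hh.2.2.2 0
    have h2 := hh.2.1
    rw [Polynomial.coe_neg, mul_neg, map_neg, PowerSeries.coeff_zero_eq_constantCoeff_apply,
      map_mul, ← PowerSeries.coeff_zero_eq_constantCoeff_apply,
      ← PowerSeries.coeff_zero_eq_constantCoeff_apply, Polynomial.coeff_coe,
      Polynomial.coeff_zero_eq_eval_zero] at h1
    linarith [mul_pos h2 h0]

end

/-! ### Quadratic forms of hereditary series and their products -/

noncomputable section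

variable {H : Type*} [NormedAddCommGroup H] [InnerProductSpace ℂ H]

/-- The quadratic form `∑ |a_n| ‖T ^ n x‖ ^ 2` is bounded. -/
def HereditaryBounded (a : PowerSeries ℝ) (T : H →L[ℂ] H) : Prop :=
  ∃ C : ℝ, ∀ (x : H) (N : ℕ),
    ∑ n ∈ Finset.range N, |PowerSeries.coeff n a| * ‖(T ^ n) x‖ ^ 2 ≤ C * ‖x‖ ^ 2

/-- The quadratic form `∑ a_n ‖T ^ n x‖ ^ 2` of `∑ a_n T^{*n} T^n`. -/
def hereditaryForm (a : PowerSeries ℝ) (T : H →L[ℂ] H) (x : H) : ℝ :=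
  ∑' n, PowerSeries.coeff n a * ‖(T ^ n) x‖ ^ 2

namespace HereditaryBounded

variable {a b : PowerSeries ℝ} {T : H →L[ℂ] H}

theorem summable_abs (ha : HereditaryBounded a T) (x : H) :
    Summable fun n => |PowerSeries.coeff n a| * ‖(T ^ n) x‖ ^ 2 := by
  obtain ⟨C, hC⟩ := ha
  exact summable_of_sum_range_le (fun n => by positivity) (hC x)

theorem summable (ha : HereditaryBounded a T) (x : H) :
    Summable fun n => PowerSeries.coeff n a * ‖(T ^ n) x‖ ^ 2 := by
  refine Summable.of_norm ((ha.summable_abs x).congr fun n => ?_)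
  rw [norm_mul, Real.norm_eq_abs, Real.norm_of_nonneg (by positivity)]

theorem hasSum (ha : HereditaryBounded a T) (x : H) :
    HasSum (fun n => PowerSeries.coeff n a * ‖(T ^ n) x‖ ^ 2) (hereditaryForm a T x) :=
  (ha.summable x).hasSum

theorem exists_tsum_le (ha : HereditaryBounded a T) : ∃ C : ℝ, 0 ≤ C ∧
    ∀ x, ∑' n, |PowerSeries.coeff n a| * ‖(T ^ n) x‖ ^ 2 ≤ C * ‖x‖ ^ 2 := by
  obtain ⟨C, hC⟩ := ha
  refine ⟨max C 0, le_max_right _ _, fun x => ?_⟩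
  refine (Real.tsum_le_of_sum_range_le (fun n => by positivity) (hC x)).trans ?_
  exact mul_le_mul_of_nonneg_right (le_max_left _ _) (by positivity)

theorem of_tsum_le {C : ℝ}
    (hs : ∀ x, Summable fun n => |PowerSeries.coeff n a| * ‖(T ^ n) x‖ ^ 2)
    (hC : ∀ x, ∑' n, |PowerSeries.coeff n a| * ‖(T ^ n) x‖ ^ 2 ≤ C * ‖x‖ ^ 2) :
    HereditaryBounded a T :=
  ⟨C, fun x N => ((hs x).sum_le_tsum _ fun n _ => by positivity).trans (hC x)⟩

/-- Tonelli: apply the bound for `b` at the vector `T^n x`, then the bound for `a` at `x`. -/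
theorem hasSum_prod_abs (ha : HereditaryBounded a T) (hb : HereditaryBounded b T) :
    ∃ C : ℝ, ∀ x, ∃ s ≤ C * ‖x‖ ^ 2, HasSum (fun p : ℕ × ℕ =>
      |PowerSeries.coeff p.1 a| * |PowerSeries.coeff p.2 b| * ‖(T ^ (p.1 + p.2)) x‖ ^ 2) s := by
  obtain ⟨A, hA0, hA⟩ := ha.exists_tsum_le
  obtain ⟨B, hB0, hB⟩ := hb.exists_tsum_le
  refine ⟨B * A, fun x => ?_⟩
  have e : ∀ n m, |PowerSeries.coeff n a| * |PowerSeries.coeff m b| * ‖(T ^ (n + m)) x‖ ^ 2 =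
      |PowerSeries.coeff n a| * (|PowerSeries.coeff m b| * ‖(T ^ m) ((T ^ n) x)‖ ^ 2) := by
    intro n m
    rw [add_comm, pow_add, mul_apply_eq_comp]
    ring
  have hle : ∀ n, ∑' m, |PowerSeries.coeff n a| * |PowerSeries.coeff m b| *
      ‖(T ^ (n + m)) x‖ ^ 2 ≤ B * (|PowerSeries.coeff n a| * ‖(T ^ n) x‖ ^ 2) := by
    intro n
    simp only [e, tsum_mul_left]
    calc _ ≤ |PowerSeries.coeff n a| * (B * ‖(T ^ n) x‖ ^ 2) :=
          mul_le_mul_of_nonneg_left (hB _) (abs_nonneg _)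
      _ = _ := by ring
  have houter : Summable fun n => ∑' m, |PowerSeries.coeff n a| * |PowerSeries.coeff m b| *
      ‖(T ^ (n + m)) x‖ ^ 2 :=
    Summable.of_nonneg_of_le (fun n => tsum_nonneg fun m => by positivity) hle
      ((ha.summable_abs x).mul_left B)
  have hs : Summable fun p : ℕ × ℕ =>
      |PowerSeries.coeff p.1 a| * |PowerSeries.coeff p.2 b| * ‖(T ^ (p.1 + p.2)) x‖ ^ 2 := by
    refine (summable_prod_of_nonneg fun p => by positivity).2 ⟨fun n => ?_, houter⟩
    simp only [e]
    exact (hb.summable_abs _).mul_left _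
  refine ⟨_, ?_, hs.hasSum⟩
  rw [hs.tsum_prod]
  calc _ ≤ ∑' n, B * (|PowerSeries.coeff n a| * ‖(T ^ n) x‖ ^ 2) :=
        houter.tsum_le_tsum hle ((ha.summable_abs x).mul_left B)
    _ ≤ B * (A * ‖x‖ ^ 2) := by
        rw [tsum_mul_left]
        exact mul_le_mul_of_nonneg_left (hA x) hB0
    _ = _ := by ring

theorem hasSum_antidiagonal {f : ℕ × ℕ → ℝ} {s : ℝ} (hf : HasSum f s) :
    HasSum (fun n => ∑ p ∈ Finset.HasAntidiagonal.antidiagonal n, f p) s := by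
  have h := (Finset.HasAntidiagonal.sigmaAntidiagonalEquivProd (A := ℕ)).hasSum_iff.2 hf
  refine (h.sigma fun n => hasSum_fintype _).congr_fun fun n => ?_
  exact (Finset.sum_coe_sort _ f).symm

theorem mul (ha : HereditaryBounded a T) (hb : HereditaryBounded b T) :
    HereditaryBounded (a * b) T := by
  obtain ⟨C, hC⟩ := ha.hasSum_prod_abs hb
  have hle : ∀ x n, |PowerSeries.coeff n (a * b)| * ‖(T ^ n) x‖ ^ 2 ≤
      ∑ p ∈ Finset.HasAntidiagonal.antidiagonal n,
        |PowerSeries.coeff p.1 a| * |PowerSeries.coeff p.2 b| * ‖(T ^ (p.1 + p.2)) x‖ ^ 2 := by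
    intro x n
    rw [PowerSeries.coeff_mul]
    refine (mul_le_mul_of_nonneg_right (Finset.abs_sum_le_sum_abs _ _) (by positivity)).trans_eq ?_
    rw [Finset.sum_mul]
    refine Finset.sum_congr rfl fun p hp => ?_
    rw [Finset.HasAntidiagonal.mem_antidiagonal.1 hp, abs_mul]
  refine of_tsum_le (C := C) (fun x => ?_) fun x => ?_
  · obtain ⟨s, -, hs⟩ := hC x
    exact Summable.of_nonneg_of_le (fun n => by positivity) (hle x)
      (hasSum_antidiagonal hs).summable
  · obtain ⟨s, hsC, hs⟩ := hC x
    refine le_trans ?_ hsC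
    rw [← (hasSum_antidiagonal hs).tsum_eq]
    exact Summable.tsum_le_tsum (hle x) (Summable.of_nonneg_of_le (fun n => by positivity) (hle x)
      (hasSum_antidiagonal hs).summable) (hasSum_antidiagonal hs).summable

/-- The absolutely convergent double series is summed along antidiagonals for the product, and along
rows for the left side. -/
theorem hasSum_hereditaryForm_mul (ha : HereditaryBounded a T) (hb : HereditaryBounded b T)
    (x : H) : HasSum (fun n => PowerSeries.coeff n a * hereditaryForm b T ((T ^ n) x))
      (hereditaryForm (a * b) T x) := by
  obtain ⟨C, hC⟩ := ha.hasSum_prod_abs hb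
  obtain ⟨s, -, hs⟩ := hC x
  have hsum : Summable fun p : ℕ × ℕ =>
      PowerSeries.coeff p.1 a * PowerSeries.coeff p.2 b * ‖(T ^ (p.1 + p.2)) x‖ ^ 2 := by
    refine Summable.of_norm (hs.summable.congr fun p => ?_)
    rw [norm_mul, norm_mul, Real.norm_eq_abs, Real.norm_eq_abs, Real.norm_of_nonneg (by positivity)]
  have h1 := hasSum_antidiagonal hsum.hasSum
  have h2 := h1.congr_fun (g := fun n => PowerSeries.coeff n (a * b) * ‖(T ^ n) x‖ ^ 2) fun n => by
    rw [PowerSeries.coeff_mul, Finset.sum_mul]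
    refine Finset.sum_congr rfl fun p hp => ?_
    rw [Finset.HasAntidiagonal.mem_antidiagonal.1 hp]
  rw [((ha.mul hb).hasSum x).unique h2]
  refine hsum.hasSum.prod_fiberwise fun n => ?_
  have := (hb.hasSum ((T ^ n) x)).mul_left (PowerSeries.coeff n a)
  refine this.congr_fun fun m => ?_
  rw [add_comm, pow_add, mul_apply_eq_comp]
  ring

end HereditaryBounded

end

/-! ### Sums of forms and boundedness from the spectrum -/

noncomputable section

section Form

variable {H : Type*} [NormedAddCommGroup H] [InnerProductSpace ℂ H]
variable {a b : PowerSeries ℝ} {T : H →L[ℂ] H}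

theorem HereditaryBounded.mono (hb : HereditaryBounded b T)
    (h : ∀ n, |PowerSeries.coeff n a| ≤ |PowerSeries.coeff n b|) : HereditaryBounded a T := by
  obtain ⟨C, hC⟩ := hb
  exact ⟨C, fun x N => (Finset.sum_le_sum fun n _ =>
    mul_le_mul_of_nonneg_right (h n) (by positivity)).trans (hC x N)⟩

theorem HereditaryBounded.add (ha : HereditaryBounded a T) (hb : HereditaryBounded b T) :
    HereditaryBounded (a + b) T := by
  obtain ⟨A, hA⟩ := ha
  obtain ⟨B, hB⟩ := hb
  refine ⟨A + B, fun x N => ?_⟩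
  rw [add_mul]
  refine le_trans ?_ (add_le_add (hA x N) (hB x N))
  rw [← Finset.sum_add_distrib]
  refine Finset.sum_le_sum fun n _ => ?_
  rw [← add_mul, map_add]
  exact mul_le_mul_of_nonneg_right (abs_add_le _ _) (by positivity)

theorem hereditaryForm_add (ha : HereditaryBounded a T) (hb : HereditaryBounded b T) (x : H) :
    hereditaryForm (a + b) T x = hereditaryForm a T x + hereditaryForm b T x := by
  refine HasSum.tsum_eq ?_
  refine ((ha.hasSum x).add (hb.hasSum x)).congr_fun fun n => ?_
  rw [map_add, add_mul]

theorem hasSum_hereditaryForm_C (c : ℝ) (x : H) :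
    HasSum (fun n => PowerSeries.coeff n (PowerSeries.C c) * ‖(T ^ n) x‖ ^ 2) (c * ‖x‖ ^ 2) := by
  have := hasSum_single (f := fun n => PowerSeries.coeff n (PowerSeries.C c) * ‖(T ^ n) x‖ ^ 2) 0
    fun n hn => by rw [PowerSeries.coeff_C, if_neg hn, zero_mul]
  simpa using this

theorem hereditaryBounded_C (c : ℝ) : HereditaryBounded (PowerSeries.C c) T := by
  have e : ∀ n, |PowerSeries.coeff n (PowerSeries.C c)| =
      PowerSeries.coeff n (PowerSeries.C |c|) := fun n => by
    rw [PowerSeries.coeff_C, PowerSeries.coeff_C]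
    split_ifs <;> simp
  refine HereditaryBounded.of_tsum_le (C := |c|) (fun x => ?_) fun x => ?_
  · simpa only [e] using (hasSum_hereditaryForm_C |c| x).summable
  · simp only [e]
    exact (hasSum_hereditaryForm_C |c| x).tsum_eq.le

/-- If the spectrum lies in the closed unit disc, then `‖T ^ n‖` grows subexponentially. -/
theorem eventually_norm_pow_sq_le [CompleteSpace H]
    (hspec : spectrum ℂ T ⊆ Metric.closedBall (0 : ℂ) 1) {R : ℝ} (hR : 1 < R) :
    ∀ᶠ n : ℕ in atTop, ‖T ^ n‖ ^ 2 ≤ R ^ n := by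
  have hr : spectralRadius ℂ T ≤ 1 := by
    refine iSup₂_le fun k hk => ?_
    have := hspec hk
    rw [mem_closedBall_zero_iff] at this
    exact_mod_cast this
  have hR1 : (1 : ENNReal) < ENNReal.ofReal √R := by
    rw [← ENNReal.ofReal_one]
    exact (ENNReal.ofReal_lt_ofReal_iff (by positivity)).2 (Real.lt_sqrt_of_sq_lt (by simpa using hR))
  have hlim := spectrum.pow_norm_pow_one_div_tendsto_nhds_spectralRadius T
  filter_upwards [hlim.eventually_lt_const (hr.trans_lt hR1), eventually_gt_atTop 0] with n hn hn0
  have h1 := ((ENNReal.ofReal_lt_ofReal_iff (by positivity)).1 hn).le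
  have h2 := pow_le_pow_left₀ (by positivity) h1 n
  rw [← Real.rpow_natCast, ← Real.rpow_mul (norm_nonneg _),
    one_div_mul_cancel (by positivity), Real.rpow_one] at h2
  calc ‖T ^ n‖ ^ 2 ≤ (√R ^ n) ^ 2 := pow_le_pow_left₀ (norm_nonneg _) h2 2
    _ = R ^ n := by rw [← pow_mul, mul_comm, pow_mul, Real.sq_sqrt (by positivity)]

/-- The spectral hypothesis makes `‖T^n‖²` eventually at most `R^n`, so a radius above one is
enough. -/
theorem hereditaryBounded_of_summable [CompleteSpace H]
    (hspec : spectrum ℂ T ⊆ Metric.closedBall (0 : ℂ) 1) {R : ℝ} (hR : 1 < R)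
    (h0 : ∀ n, 0 ≤ PowerSeries.coeff n a)
    (hs : Summable fun n => PowerSeries.coeff n a * R ^ n) : HereditaryBounded a T := by
  have hsum : Summable fun n => PowerSeries.coeff n a * ‖T ^ n‖ ^ 2 := by
    refine Summable.of_norm_bounded_eventually_nat hs ?_
    filter_upwards [eventually_norm_pow_sq_le hspec hR] with n hn
    rw [Real.norm_of_nonneg (mul_nonneg (h0 n) (by positivity))]
    exact mul_le_mul_of_nonneg_left hn (h0 n)
  refine ⟨∑' n, PowerSeries.coeff n a * ‖T ^ n‖ ^ 2, fun x N => ?_⟩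
  refine le_trans (Finset.sum_le_sum fun n _ => ?_) ((Finset.sum_mul _ _ _).symm.le.trans
    (mul_le_mul_of_nonneg_right (hsum.sum_le_tsum (Finset.range N)
      fun n _ => mul_nonneg (h0 n) (by positivity)) (by positivity)))
  rw [abs_of_nonneg (h0 n), mul_assoc, ← mul_pow]
  exact mul_le_mul_of_nonneg_left (pow_le_pow_left₀ (norm_nonneg _)
    ((T ^ n).le_opNorm x) 2) (h0 n)

theorem hereditaryForm_mul_nonneg (ha : HereditaryBounded a T) (hb : HereditaryBounded b T)
    (h0 : ∀ n, 0 ≤ PowerSeries.coeff n a) (hform : ∀ x, 0 ≤ hereditaryForm b T x) (x : H) :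
    0 ≤ hereditaryForm (a * b) T x :=
  (ha.hasSum_hereditaryForm_mul hb x).nonneg fun n => mul_nonneg (h0 n) (hform _)

end Form

/-! ### From forms to operators -/

section Operator

variable {H : Type*} [NormedAddCommGroup H] [InnerProductSpace ℂ H] [CompleteSpace H]
variable {a b : PowerSeries ℝ} {T : H →L[ℂ] H}

theorem inner_adjoint_pow_mul_pow (T : H →L[ℂ] H) (n : ℕ) (x y : H) :
    inner ℂ y (((ContinuousLinearMap.adjoint T) ^ n * T ^ n) x) =
      inner ℂ ((T ^ n) y) ((T ^ n) x) := by
  have h : (ContinuousLinearMap.adjoint T) ^ n = ContinuousLinearMap.adjoint (T ^ n) := by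
    rw [← ContinuousLinearMap.star_eq_adjoint, ← ContinuousLinearMap.star_eq_adjoint, star_pow]
  rw [h, mul_apply_eq_comp, ContinuousLinearMap.adjoint_inner_right]

theorem inner_hereditaryPartialSum (c : ℕ → ℝ) (T : H →L[ℂ] H) (N : ℕ) (x : H) :
    inner ℂ x (hereditaryPartialSum (fun n => (c n : ℂ)) T N x) =
      ((∑ n ∈ Finset.range N, c n * ‖(T ^ n) x‖ ^ 2 : ℝ) : ℂ) := by
  rw [hereditaryPartialSum, sum_apply, inner_sum, Complex.ofReal_sum]
  refine Finset.sum_congr rfl fun n _ => ?_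
  rw [smul_apply, inner_smul_right, inner_adjoint_pow_mul_pow,
    inner_self_eq_norm_sq_to_K]
  push_cast
  rfl

/-- Pair the finite sum `v` with itself, use Cauchy–Schwarz with weights `|a_n|`, bound the factor
in `v` by `C‖v‖²` and cancel `‖v‖²`. This gives the Cauchy criterion for strong convergence from
convergence of the scalar form. -/
theorem norm_sum_hereditary_sq_le {C : ℝ} (hC0 : 0 ≤ C)
    (hC : ∀ x, ∑' n, |PowerSeries.coeff n a| * ‖(T ^ n) x‖ ^ 2 ≤ C * ‖x‖ ^ 2)
    (ha : HereditaryBounded a T) (x : H) (t : Finset ℕ) :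
    ‖∑ n ∈ t, ((PowerSeries.coeff n a : ℝ) : ℂ) •
      ((ContinuousLinearMap.adjoint T) ^ n * T ^ n) x‖ ^ 2 ≤
      C * ∑ n ∈ t, |PowerSeries.coeff n a| * ‖(T ^ n) x‖ ^ 2 := by
  set v := ∑ n ∈ t, ((PowerSeries.coeff n a : ℝ) : ℂ) •
      ((ContinuousLinearMap.adjoint T) ^ n * T ^ n) x with hv
  have hle : ‖v‖ ^ 2 ≤ ∑ n ∈ t, (√|PowerSeries.coeff n a| * ‖(T ^ n) v‖) *
      (√|PowerSeries.coeff n a| * ‖(T ^ n) x‖) := by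
    have h1 : ‖v‖ ^ 2 = ‖inner ℂ v v‖ := by
      rw [inner_self_eq_norm_sq_to_K, norm_pow, RCLike.norm_ofReal, abs_norm]
    rw [h1]
    nth_rewrite 2 [hv]
    rw [inner_sum]
    refine (norm_sum_le _ _).trans (Finset.sum_le_sum fun n _ => ?_)
    rw [inner_smul_right, inner_adjoint_pow_mul_pow, norm_mul, Complex.norm_real, Real.norm_eq_abs]
    calc _ ≤ |PowerSeries.coeff n a| * (‖(T ^ n) v‖ * ‖(T ^ n) x‖) :=
          mul_le_mul_of_nonneg_left (norm_inner_le_norm _ _) (abs_nonneg _)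
      _ = (√|PowerSeries.coeff n a| * √|PowerSeries.coeff n a|) *
          (‖(T ^ n) v‖ * ‖(T ^ n) x‖) := by rw [Real.mul_self_sqrt (abs_nonneg _)]
      _ = _ := by ring
  have hsq : ∀ y, ∑ n ∈ t, (√|PowerSeries.coeff n a| * ‖(T ^ n) y‖) ^ 2 =
      ∑ n ∈ t, |PowerSeries.coeff n a| * ‖(T ^ n) y‖ ^ 2 := fun y =>
    Finset.sum_congr rfl fun n _ => by rw [mul_pow, Real.sq_sqrt (abs_nonneg _)]
  have hcs := (pow_le_pow_left₀ (by positivity) hle 2).trans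
    (Finset.sum_mul_sq_le_sq_mul_sq t _ _)
  rw [hsq, hsq] at hcs
  have hvC : ∑ n ∈ t, |PowerSeries.coeff n a| * ‖(T ^ n) v‖ ^ 2 ≤ C * ‖v‖ ^ 2 :=
    ((ha.summable_abs v).sum_le_tsum t fun n _ => by positivity).trans (hC v)
  have hS0 : 0 ≤ ∑ n ∈ t, |PowerSeries.coeff n a| * ‖(T ^ n) x‖ ^ 2 :=
    Finset.sum_nonneg fun n _ => by positivity
  have hfin := hcs.trans (mul_le_mul_of_nonneg_right hvC hS0)
  rcases (sq_nonneg ‖v‖).eq_or_lt with h0 | h0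
  · rw [← h0]
    exact mul_nonneg hC0 hS0
  · refine le_of_mul_le_mul_left ?_ h0
    calc ‖v‖ ^ 2 * ‖v‖ ^ 2 = (‖v‖ ^ 2) ^ 2 := by ring
      _ ≤ _ := hfin
      _ = _ := by ring

theorem HereditaryBounded.summable_apply (ha : HereditaryBounded a T) (x : H) :
    Summable fun n => ((PowerSeries.coeff n a : ℝ) : ℂ) •
      ((ContinuousLinearMap.adjoint T) ^ n * T ^ n) x := by
  obtain ⟨C, hC0, hC⟩ := ha.exists_tsum_le
  rw [summable_iff_vanishing_norm]
  intro ε hε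
  obtain ⟨s, hs⟩ := summable_iff_vanishing_norm.1 (ha.summable_abs x) (ε ^ 2 / (C + 1))
    (by positivity)
  refine ⟨s, fun t ht => ?_⟩
  have h1 := norm_sum_hereditary_sq_le hC0 hC ha x t
  have h2 := hs t ht
  rw [Real.norm_of_nonneg (Finset.sum_nonneg fun n _ => by positivity)] at h2
  rw [lt_div_iff₀ (by positivity)] at h2
  have hS0 : 0 ≤ ∑ n ∈ t, |PowerSeries.coeff n a| * ‖(T ^ n) x‖ ^ 2 :=
    Finset.sum_nonneg fun n _ => by positivity
  refine lt_of_pow_lt_pow_left₀ 2 hε.le ?_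
  linarith

/-- The pointwise limit is bounded by the uniform boundedness principle. -/
theorem HereditaryBounded.exists_hasHereditarySumSOT (ha : HereditaryBounded a T) :
    ∃ A : H →L[ℂ] H, HasHereditarySumSOT (fun n => ((PowerSeries.coeff n a : ℝ) : ℂ)) T A ∧
      ∀ x, inner ℂ x (A x) = (hereditaryForm a T x : ℂ) := by
  have hlim : Tendsto (fun N x => hereditaryPartialSum (fun n => ((PowerSeries.coeff n a : ℝ) : ℂ)) T N x)
      atTop (𝓝 fun x => ∑' n, ((PowerSeries.coeff n a : ℝ) : ℂ) •
      ((ContinuousLinearMap.adjoint T) ^ n * T ^ n) x) := by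
    refine tendsto_pi_nhds.2 fun x => ?_
    refine (ha.summable_apply x).hasSum.tendsto_sum_nat.congr fun N => ?_
    simp [hereditaryPartialSum, sum_apply]
  have hA : HasHereditarySumSOT (fun n => ((PowerSeries.coeff n a : ℝ) : ℂ)) T
      (continuousLinearMapOfTendsto _ hlim) := fun x => tendsto_pi_nhds.1 hlim x
  refine ⟨_, hA, fun x => ?_⟩
  have h1 : Tendsto (fun N => inner ℂ x (hereditaryPartialSum
      (fun n => ((PowerSeries.coeff n a : ℝ) : ℂ)) T N x)) atTop (𝓝 _) :=
    ((innerSL ℂ x).continuous.tendsto _).comp (hA x)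
  simp only [inner_hereditaryPartialSum] at h1
  exact tendsto_nhds_unique h1
    ((Complex.continuous_ofReal.tendsto _).comp (ha.hasSum x).tendsto_sum_nat)

theorem HasHereditarySumSOT.hereditaryForm_eq {A : H →L[ℂ] H}
    (hA : HasHereditarySumSOT (fun n => ((PowerSeries.coeff n a : ℝ) : ℂ)) T A)
    (ha : HereditaryBounded a T) (x : H) : inner ℂ x (A x) = (hereditaryForm a T x : ℂ) := by
  obtain ⟨B, hB, hBx⟩ := ha.exists_hasHereditarySumSOT
  rw [tendsto_nhds_unique (hA x) (hB x), hBx]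

/-- The partial sums of the form increase, so each is at most its limit `⟨x, A x⟩`. -/
theorem hereditaryBounded_of_hasHereditarySumSOT {A : H →L[ℂ] H}
    (hA : HasHereditarySumSOT (fun n => ((|PowerSeries.coeff n a| : ℝ) : ℂ)) T A) :
    HereditaryBounded a T := by
  refine ⟨‖A‖, fun x N => ?_⟩
  have h1 : Tendsto (fun N => inner ℂ x (hereditaryPartialSum
      (fun n => ((|PowerSeries.coeff n a| : ℝ) : ℂ)) T N x)) atTop (𝓝 _) :=
    ((innerSL ℂ x).continuous.tendsto _).comp (hA x)
  simp only [inner_hereditaryPartialSum] at h1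
  have h2 := (Complex.continuous_re.tendsto _).comp h1
  have hmono : Monotone fun N =>
      ∑ n ∈ Finset.range N, |PowerSeries.coeff n a| * ‖(T ^ n) x‖ ^ 2 :=
    monotone_nat_of_le_succ fun N => by
      rw [Finset.sum_range_succ]
      exact le_add_of_nonneg_right (by positivity)
  refine (hmono.ge_of_tendsto h2 N).trans ?_
  calc _ ≤ ‖inner ℂ x (A x)‖ := Complex.re_le_norm _
    _ ≤ ‖x‖ * ‖A x‖ := norm_inner_le_norm _ _
    _ ≤ ‖x‖ * (‖A‖ * ‖x‖) := mul_le_mul_of_nonneg_left (A.le_opNorm x) (norm_nonneg _)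
    _ = _ := by ring

theorem HasHereditarySumNorm.hasHereditarySumSOT {c : ℕ → ℂ} {A : H →L[ℂ] H}
    (hA : HasHereditarySumNorm c T A) : HasHereditarySumSOT c T A := fun x =>
  ((ContinuousLinearMap.apply ℂ H x).continuous.tendsto A).comp hA

/-- The Cauchy property in operator norm makes the tails of the form small uniformly on the unit
ball. -/
theorem HasHereditarySumNorm.eventually_tail_le {A : H →L[ℂ] H}
    (hA : HasHereditarySumNorm (fun n => ((|PowerSeries.coeff n a| : ℝ) : ℂ)) T A) {ε : ℝ}
    (hε : 0 < ε) : ∀ᶠ N in atTop, ∀ M x,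
      ∑ n ∈ Finset.range M, (if n < N then 0 else |PowerSeries.coeff n a|) * ‖(T ^ n) x‖ ^ 2 ≤
        ε * ‖x‖ ^ 2 := by
  obtain ⟨N₀, hN₀⟩ := Metric.cauchySeq_iff'.1 hA.cauchySeq (ε / 2) (by positivity)
  filter_upwards [eventually_ge_atTop N₀] with N hN M x
  set S := hereditaryPartialSum (fun n => ((|PowerSeries.coeff n a| : ℝ) : ℂ)) T
  rcases le_total M N with hMN | hMN
  · rw [Finset.sum_eq_zero]
    · positivity
    · intro n hn
      rw [if_pos ((Finset.mem_range.1 hn).trans_le hMN), zero_mul]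
  have hsplit : ((∑ n ∈ Finset.range M, (if n < N then 0 else |PowerSeries.coeff n a|) *
      ‖(T ^ n) x‖ ^ 2 : ℝ) : ℂ) = inner ℂ x ((S M - S N) x) := by
    rw [sub_apply, inner_sub_right, inner_hereditaryPartialSum,
      inner_hereditaryPartialSum, ← Complex.ofReal_sub, ← Finset.sum_range_add_sum_Ico _ hMN,
      ← Finset.sum_range_add_sum_Ico (fun n => |PowerSeries.coeff n a| * ‖(T ^ n) x‖ ^ 2) hMN,
      add_sub_cancel_left, Finset.sum_eq_zero (s := Finset.range N), zero_add]
    · congr 1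
      refine Finset.sum_congr rfl fun n hn => ?_
      rw [if_neg (not_lt.2 (Finset.mem_Ico.1 hn).1)]
    · intro n hn
      rw [if_pos (Finset.mem_range.1 hn), zero_mul]
  have hnorm : ‖S M - S N‖ ≤ ε := by
    rw [← dist_eq_norm]
    linarith [dist_triangle_right (S M) (S N) (S N₀), hN₀ M (hN.trans hMN), hN₀ N hN]
  calc _ ≤ ‖inner ℂ x ((S M - S N) x)‖ := by
        rw [← hsplit, Complex.norm_real]
        exact Real.le_norm_self _
    _ ≤ ‖x‖ * ‖(S M - S N) x‖ := norm_inner_le_norm _ _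
    _ ≤ ‖x‖ * (ε * ‖x‖) := mul_le_mul_of_nonneg_left
        (((S M - S N).le_opNorm x).trans (by gcongr)) (norm_nonneg _)
    _ = _ := by ring

/-- A coercive positive operator is `V^* V` for some bounded invertible `V`. -/
theorem exists_equiv_norm_sq_eq {G : H →L[ℂ] H} {q : H → ℝ}
    (hG : ∀ x, inner ℂ x (G x) = (q x : ℂ)) {c : ℝ} (hc : 0 < c)
    (hq : ∀ x, c * ‖x‖ ^ 2 ≤ q x) : ∃ V : H ≃L[ℂ] H, ∀ x, ‖V x‖ ^ 2 = q x := by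
  have hG' : ∀ x, inner ℂ (G x) x = (q x : ℂ) := fun x => by
    rw [← inner_conj_symm, hG, Complex.conj_ofReal]
  have hq0 : ∀ x, 0 ≤ q x := fun x => le_trans (by positivity) (hq x)
  have hpos : G.IsPositive := by
    rw [ContinuousLinearMap.isPositive_iff_complex]
    intro x
    simp [hG', hq0]
  have hunit : IsUnit G := by
    refine ContinuousLinearMap.isUnit_of_forall_le_norm_inner_map G (c := ⟨c, hc.le⟩) hc fun x => ?_
    rw [hG', Complex.norm_real, Real.norm_of_nonneg (hq0 x), mul_comm]
    exact hq x
  have h0 : 0 ≤ G := (ContinuousLinearMap.nonneg_iff_isPositive G).2 hpos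
  -- `V` is the positive square root of `G`, invertible because its square is.
  have hsqrt : CFC.sqrt G * CFC.sqrt G = G := CFC.sqrt_mul_sqrt_self G h0
  have hsa : IsSelfAdjoint (CFC.sqrt G) := (CFC.sqrt_nonneg G).isSelfAdjoint
  have hV : IsUnit (CFC.sqrt G) := by
    rw [← hsqrt] at hunit
    exact ((Commute.refl _).isUnit_mul_iff.1 hunit).1
  refine ⟨ContinuousLinearEquiv.unitsEquiv ℂ H hV.unit, fun x => ?_⟩
  have hVx : ContinuousLinearEquiv.unitsEquiv ℂ H hV.unit x = CFC.sqrt G x := rfl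
  rw [hVx]
  have h1 : inner ℂ (CFC.sqrt G x) (CFC.sqrt G x) = (q x : ℂ) := by
    rw [← ContinuousLinearMap.adjoint_inner_right, ← ContinuousLinearMap.star_eq_adjoint,
      hsa.star_eq, ← mul_apply_eq_comp, hsqrt, hG]
  have h2 := inner_self_eq_norm_sq (𝕜 := ℂ) (CFC.sqrt G x)
  rw [h1] at h2
  simpa using h2.symm

end Operator

end

/-! ### Taylor coefficients and the Wiener algebra -/

noncomputable section

section Taylor

theorem analyticAt_of_mem_wienerAlgebra {f : ℂ → ℂ} (hf : f ∈ WienerAlgebra) :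
    AnalyticAt ℂ f 0 := by
  refine ⟨FormalMultilinearSeries.ofScalars ℂ (taylorCoeff f), 1, ?_, one_pos, fun {z} hz => ?_⟩
  · have h : Summable fun n => ‖FormalMultilinearSeries.ofScalars ℂ (taylorCoeff f) n‖ *
        ((1 : NNReal) : ℝ) ^ n := by
      refine hf.1.congr fun n => ?_
      rw [FormalMultilinearSeries.ofScalars_norm]
      simp
    exact_mod_cast FormalMultilinearSeries.le_radius_of_summable _ h
  · have hz' : z ∈ Metric.closedBall (0 : ℂ) 1 := by
      rw [mem_closedBall_zero_iff]
      rw [mem_eball_zero_iff, ← ofReal_norm] at hz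
      exact ENNReal.ofReal_le_one.1 hz.le
    rw [zero_add]
    refine (hf.2 z hz').congr_fun fun n => ?_
    simp [mul_comm]

/-- Leibniz's rule at the origin; agreement near 0 is enough. -/
theorem taylorCoeff_mul {f g k : ℂ → ℂ} (hf : f ∈ WienerAlgebra) (hg : g ∈ WienerAlgebra)
    (hk : ∀ z ∈ Metric.ball (0 : ℂ) 1, k z = f z * g z) (n : ℕ) :
    taylorCoeff k n = ∑ p ∈ Finset.HasAntidiagonal.antidiagonal n,
      taylorCoeff f p.1 * taylorCoeff g p.2 := by
  have heq : k =ᶠ[𝓝 0] f * g := by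
    filter_upwards [Metric.ball_mem_nhds (0 : ℂ) one_pos] with z hz using hk z hz
  have h1 := (heq.iteratedDeriv n).self_of_nhds
  rw [taylorCoeff, h1, iteratedDeriv_mul (analyticAt_of_mem_wienerAlgebra hf).contDiffAt
    (analyticAt_of_mem_wienerAlgebra hg).contDiffAt, Finset.sum_div,
    Finset.Nat.sum_antidiagonal_eq_sum_range_succ (fun i j => taylorCoeff f i * taylorCoeff g j)]
  refine Finset.sum_congr rfl fun i hi => ?_
  have hin : i ≤ n := Nat.lt_succ_iff.1 (Finset.mem_range.1 hi)
  rw [taylorCoeff, taylorCoeff, Nat.cast_choose ℂ hin]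
  have h2 : (n.factorial : ℂ) ≠ 0 := Nat.cast_ne_zero.2 n.factorial_ne_zero
  field_simp

/-- The power series of the real parts of the Taylor coefficients. -/
def realTaylorSeries (f : ℂ → ℂ) : PowerSeries ℝ :=
  PowerSeries.mk fun n => (taylorCoeff f n).re

theorem taylorCoeff_eq_coeff {f : ℂ → ℂ} (hf : ∀ n, (taylorCoeff f n).im = 0) (n : ℕ) :
    taylorCoeff f n = ((PowerSeries.coeff n (realTaylorSeries f) : ℝ) : ℂ) := by
  rw [realTaylorSeries, PowerSeries.coeff_mk]
  exact Complex.ext (by simp) (by simp [hf n])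

theorem norm_taylorCoeff_eq_abs_coeff {f : ℂ → ℂ} (hf : ∀ n, (taylorCoeff f n).im = 0) (n : ℕ) :
    ‖taylorCoeff f n‖ = |PowerSeries.coeff n (realTaylorSeries f)| := by
  rw [taylorCoeff_eq_coeff hf, Complex.norm_real, Real.norm_eq_abs]

theorem hasSum_realTaylorSeries {f : ℂ → ℂ} (hf : f ∈ WienerAlgebra)
    (hf' : ∀ n, (taylorCoeff f n).im = 0) {t : ℝ} (ht : t ∈ Set.Icc (0 : ℝ) 1) :
    HasSum (fun n => PowerSeries.coeff n (realTaylorSeries f) * t ^ n) (f (t : ℂ)).re := by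
  have h := Complex.hasSum_re (hf.2 (t : ℂ) (by
    rw [mem_closedBall_zero_iff, Complex.norm_real, Real.norm_of_nonneg ht.1]; exact ht.2))
  refine h.congr_fun fun n => ?_
  rw [taylorCoeff_eq_coeff hf', ← Complex.ofReal_pow, ← Complex.ofReal_mul, Complex.ofReal_re]

theorem taylorCoeff_mul_eq_coeff {f g k : ℂ → ℂ} (hf : f ∈ WienerAlgebra) (hg : g ∈ WienerAlgebra)
    (hf' : ∀ n, (taylorCoeff f n).im = 0) (hg' : ∀ n, (taylorCoeff g n).im = 0)
    (hk : ∀ z ∈ Metric.ball (0 : ℂ) 1, k z = f z * g z) (n : ℕ) :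
    taylorCoeff k n =
      ((PowerSeries.coeff n (realTaylorSeries f * realTaylorSeries g) : ℝ) : ℂ) := by
  rw [taylorCoeff_mul hf hg hk, PowerSeries.coeff_mul, Complex.ofReal_sum]
  refine Finset.sum_congr rfl fun p _ => ?_
  rw [taylorCoeff_eq_coeff hf', taylorCoeff_eq_coeff hg', Complex.ofReal_mul]

/-- An absolutely convergent power series that is positive on `[0, 1]` is bounded below there,
uniformly in its partial sums of high order. -/
theorem exists_lt_eval_trunc {g : PowerSeries ℝ} {φ : ℝ → ℝ}
    (hs : Summable fun n => |PowerSeries.coeff n g|)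
    (hφ : ∀ t ∈ Set.Icc (0 : ℝ) 1, HasSum (fun n => PowerSeries.coeff n g * t ^ n) (φ t))
    (hpos : ∀ t ∈ Set.Icc (0 : ℝ) 1, 0 < φ t) :
    ∃ δ > 0, ∀ᶠ N in atTop, ∀ t ∈ Set.Icc (0 : ℝ) 1, δ < (PowerSeries.trunc N g).eval t := by
  have hbound : ∀ n, ∀ t ∈ Set.Icc (0 : ℝ) 1,
      ‖PowerSeries.coeff n g * t ^ n‖ ≤ |PowerSeries.coeff n g| := fun n t ht => by
    rw [norm_mul, Real.norm_eq_abs, norm_pow, Real.norm_of_nonneg ht.1]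
    exact mul_le_of_le_one_right (abs_nonneg _) (pow_le_one₀ ht.1 ht.2)
  have hunif := tendstoUniformlyOn_tsum_nat hs hbound
  have hφ' : ∀ t ∈ Set.Icc (0 : ℝ) 1, ∑' n, PowerSeries.coeff n g * t ^ n = φ t :=
    fun t ht => (hφ t ht).tsum_eq
  have hcont : ContinuousOn (fun t : ℝ => ∑' n, PowerSeries.coeff n g * t ^ n) (Set.Icc 0 1) :=
    continuousOn_tsum (fun n => by fun_prop) hs hbound
  obtain ⟨t₀, ht₀, hmin⟩ := isCompact_Icc.exists_isMinOn (Set.nonempty_Icc.2 zero_le_one) hcont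
  have h0 := hpos t₀ ht₀
  -- Half the minimum on [0, 1]; uniform convergence keeps late partial sums above it.
  refine ⟨φ t₀ / 2, half_pos h0, ?_⟩
  filter_upwards [Metric.tendstoUniformlyOn_iff.1 hunif (φ t₀ / 2) (half_pos h0)] with N hN t ht
  have h1 := hN t ht
  have h2 := hmin ht
  simp only [Set.mem_ofPred_eq, hφ' t₀ ht₀] at h2
  have h3 : (PowerSeries.trunc N g).eval t =
      ∑ n ∈ Finset.range N, PowerSeries.coeff n g * t ^ n :=
    PowerSeries.eval₂_trunc_eq_sum_range t (RingHom.id ℝ) N g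
  rw [h3]
  rw [Real.dist_eq] at h1
  linarith [(abs_lt.1 h1).2]

end Taylor

/-! ### Similarity -/

theorem conj_pow_apply {H : Type*} [NormedAddCommGroup H] [InnerProductSpace ℂ H]
    (T : H →L[ℂ] H) (V : H ≃L[ℂ] H) (n : ℕ) (x : H) :
    (((V : H →L[ℂ] H) ∘L T ∘L (V.symm : H →L[ℂ] H)) ^ n) (V x) = V ((T ^ n) x) := by
  induction n with
  | zero => simp
  | succ n ih => rw [pow_succ', mul_apply_eq_comp, ih, pow_succ', mul_apply_eq_comp]; simp

theorem HereditaryBounded.conj {H : Type*} [NormedAddCommGroup H]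
    [InnerProductSpace ℂ H] {a : PowerSeries ℝ} {T : H →L[ℂ] H} (ha : HereditaryBounded a T)
    (V : H ≃L[ℂ] H) :
    HereditaryBounded a ((V : H →L[ℂ] H) ∘L T ∘L (V.symm : H →L[ℂ] H)) := by
  obtain ⟨C, hC0, hC⟩ := ha.exists_tsum_le
  refine ⟨‖(V : H →L[ℂ] H)‖ ^ 2 * (C * ‖(V.symm : H →L[ℂ] H)‖ ^ 2), fun y N => ?_⟩
  obtain ⟨x, rfl⟩ := V.surjective y
  have hx : ‖x‖ ≤ ‖(V.symm : H →L[ℂ] H)‖ * ‖V x‖ := by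
    simpa using (V.symm : H →L[ℂ] H).le_opNorm (V x)
  calc _ ≤ ∑ n ∈ Finset.range N, ‖(V : H →L[ℂ] H)‖ ^ 2 *
          (|PowerSeries.coeff n a| * ‖(T ^ n) x‖ ^ 2) := by
        refine Finset.sum_le_sum fun n _ => ?_
        rw [conj_pow_apply, mul_left_comm, ← mul_pow]
        exact mul_le_mul_of_nonneg_left (pow_le_pow_left₀ (norm_nonneg _)
          ((V : H →L[ℂ] H).le_opNorm _) 2) (abs_nonneg _)
    _ ≤ ‖(V : H →L[ℂ] H)‖ ^ 2 * (C * ‖x‖ ^ 2) := by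
        rw [← Finset.mul_sum]
        exact mul_le_mul_of_nonneg_left (((ha.summable_abs x).sum_le_tsum _
          fun n _ => by positivity).trans (hC x)) (by positivity)
    _ ≤ ‖(V : H →L[ℂ] H)‖ ^ 2 * (C * (‖(V.symm : H →L[ℂ] H)‖ * ‖V x‖) ^ 2) := by gcongr
    _ = _ := by ring

/-! ### The coercive product and the main theorem -/

section Main

variable {H : Type*} [NormedAddCommGroup H] [InnerProductSpace ℂ H] [CompleteSpace H]

/-- A power series positive on `[0, 1]` has a multiplier with nonnegative coefficients such that
the product has a coercive hereditary form. -/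
theorem exists_multiplier_coercive {T : H →L[ℂ] H}
    (hspec : spectrum ℂ T ⊆ Metric.closedBall (0 : ℂ) 1) {g : PowerSeries ℝ} {φ : ℝ → ℝ}
    {A : H →L[ℂ] H}
    (hA : HasHereditarySumNorm (fun n => ((|PowerSeries.coeff n g| : ℝ) : ℂ)) T A)
    (hs : Summable fun n => |PowerSeries.coeff n g|)
    (hφ : ∀ t ∈ Set.Icc (0 : ℝ) 1, HasSum (fun n => PowerSeries.coeff n g * t ^ n) (φ t))
    (hpos : ∀ t ∈ Set.Icc (0 : ℝ) 1, 0 < φ t) :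
    ∃ h : PowerSeries ℝ, (∀ n, 0 ≤ PowerSeries.coeff n h) ∧ HereditaryBounded h T ∧
      ∃ c > 0, ∀ x, c * ‖x‖ ^ 2 ≤ hereditaryForm (h * g) T x := by
  have hg : HereditaryBounded g T :=
    hereditaryBounded_of_hasHereditarySumSOT hA.hasHereditarySumSOT
  obtain ⟨δ, hδ, htrunc⟩ := exists_lt_eval_trunc hs hφ hpos
  obtain ⟨N, hN, htail⟩ := (htrunc.and (hA.eventually_tail_le (half_pos hδ))).exists
  -- The `δ` removed here is returned to the tail, where it dominates `r`.
  set p := PowerSeries.trunc N g - Polynomial.C δ with hp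
  obtain ⟨h, h0, h1, ⟨R, hR, hsum⟩, h2⟩ := exists_isPositiveMultiplier (p := p) fun t ht => by
    have := hN t ht
    simp only [hp, Polynomial.eval_sub, Polynomial.eval_C]
    linarith
  have hh : HereditaryBounded h T := hereditaryBounded_of_summable hspec hR h0 hsum
  refine ⟨h, h0, hh, PowerSeries.coeff 0 h * (δ / 2), by positivity, fun x => ?_⟩
  set r : PowerSeries ℝ := PowerSeries.mk fun n => if n < N then 0 else PowerSeries.coeff n g
    with hr
  have hrabs : ∀ n, |PowerSeries.coeff n r| = if n < N then 0 else |PowerSeries.coeff n g| :=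
    fun n => by
      rw [hr, PowerSeries.coeff_mk]
      split_ifs <;> simp
  have hrb : HereditaryBounded r T := hg.mono fun n => by
    rw [hrabs]
    split_ifs
    exacts [abs_nonneg _, le_rfl]
  have hkb : HereditaryBounded (PowerSeries.C δ + r) T := (hereditaryBounded_C δ).add hrb
  have hpb : HereditaryBounded (p : PowerSeries ℝ) T := by
    have hpt : HereditaryBounded ((PowerSeries.trunc N g : Polynomial ℝ) : PowerSeries ℝ) T :=
      hg.mono fun n => by
        rw [Polynomial.coeff_coe, PowerSeries.coeff_trunc]
        split_ifs <;> simp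
    have : (p : PowerSeries ℝ) = (PowerSeries.trunc N g : Polynomial ℝ) + PowerSeries.C (-δ) := by
      rw [hp, Polynomial.coe_sub, Polynomial.coe_C, map_neg, sub_eq_add_neg]
    rw [this]
    exact hpt.add (hereditaryBounded_C _)
  have hdecomp : g = (p : PowerSeries ℝ) + (PowerSeries.C δ + r) := by
    ext n
    rw [hp, Polynomial.coe_sub, Polynomial.coe_C, map_add, map_sub, map_add, Polynomial.coeff_coe,
      PowerSeries.coeff_trunc, hr, PowerSeries.coeff_mk]
    split_ifs <;> ring
  have hk : ∀ y, δ / 2 * ‖y‖ ^ 2 ≤ hereditaryForm (PowerSeries.C δ + r) T y := by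
    intro y
    have hrt : ∑' n, |PowerSeries.coeff n r| * ‖(T ^ n) y‖ ^ 2 ≤ δ / 2 * ‖y‖ ^ 2 :=
      Real.tsum_le_of_sum_range_le (fun n => by positivity) fun M => by
        simpa only [hrabs] using htail M y
    have hr1 : -∑' n, |PowerSeries.coeff n r| * ‖(T ^ n) y‖ ^ 2 ≤ hereditaryForm r T y := by
      rw [← tsum_neg]
      refine (hrb.summable_abs y).neg.tsum_le_tsum (fun n => ?_) (hrb.summable y)
      rw [← neg_mul]
      exact mul_le_mul_of_nonneg_right (neg_abs_le _) (by positivity)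
    rw [hereditaryForm_add (hereditaryBounded_C δ) hrb, hereditaryForm,
      (hasSum_hereditaryForm_C δ y).tsum_eq]
    linarith
  have hk0 : ∀ y, 0 ≤ hereditaryForm (PowerSeries.C δ + r) T y := fun y =>
    le_trans (by positivity) (hk y)
  have hpform : 0 ≤ hereditaryForm (h * (p : PowerSeries ℝ)) T x :=
    tsum_nonneg fun n => mul_nonneg (h2 n) (by positivity)
  have hkform : PowerSeries.coeff 0 h * (δ / 2) * ‖x‖ ^ 2 ≤
      hereditaryForm (h * (PowerSeries.C δ + r)) T x := by
    -- All terms are nonnegative, so the term `n = 0` alone is a lower bound; this is why `h_0 > 0`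
    -- is required.
    have h3 := le_hasSum (hh.hasSum_hereditaryForm_mul hkb x) 0
      fun n _ => mul_nonneg (h0 n) (hk0 _)
    refine le_trans ?_ h3
    rw [mul_assoc, pow_zero]
    exact mul_le_mul_of_nonneg_left (hk x) h1.le
  rw [hdecomp, mul_add, hereditaryForm_add (hh.mul hpb) (hh.mul hkb)]
  linarith

end Main

end

theorem theorem1p1 {H : Type*} [NormedAddCommGroup H] [InnerProductSpace ℂ H] [CompleteSpace H]
    [TopologicalSpace.SeparableSpace H]
    (That : H →L[ℂ] H) (hspec : spectrum ℂ That ⊆ Metric.closedBall (0 : ℂ) 1)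
    (α γt γ : ℂ → ℂ)
    (hα : α ∈ algAReal That)
    (hγt : γt ∈ algAZeroReal That)
    (hpos : ∀ t : ℝ, t ∈ Set.Icc (0 : ℝ) 1 → 0 < (γt (t : ℂ)).re)
    (hγ : ∀ z ∈ Metric.ball (0 : ℂ) 1, γ z = α z * γt z)
    (hnonneg : HereditaryNonneg γ That) :
    ∃ T : H →L[ℂ] H, SimilarOperators That T ∧ HereditaryNonneg α T := by
  obtain ⟨⟨hαW, A₁, hA₁⟩, hαR⟩ := hα
  obtain ⟨⟨hγW, A₂, hA₂⟩, hγR⟩ := hγt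
  obtain ⟨Γ, hΓ, hΓpos⟩ := hnonneg
  simp only [norm_taylorCoeff_eq_abs_coeff hαR] at hA₁
  simp only [norm_taylorCoeff_eq_abs_coeff hγR] at hA₂
  set a := realTaylorSeries α
  set g := realTaylorSeries γt
  have ha : HereditaryBounded a That := hereditaryBounded_of_hasHereditarySumSOT hA₁
  have hg : HereditaryBounded g That :=
    hereditaryBounded_of_hasHereditarySumSOT hA₂.hasHereditarySumSOT
  rw [funext (taylorCoeff_mul_eq_coeff hαW hγW hαR hγR hγ)] at hΓ
  have hag : ∀ x, 0 ≤ hereditaryForm (a * g) That x := fun x => by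
    have h1 := hΓpos.inner_nonneg_right x
    rw [hΓ.hereditaryForm_eq (ha.mul hg)] at h1
    exact_mod_cast h1
  obtain ⟨h, h0, hh, c, hc, hcoer⟩ := exists_multiplier_coercive hspec hA₂
    (by simpa only [norm_taylorCoeff_eq_abs_coeff hγR] using hγW.1)
    (fun t ht => hasSum_realTaylorSeries hγW hγR ht) hpos
  obtain ⟨G, -, hG⟩ := (hh.mul hg).exists_hasHereditarySumSOT
  -- In the new norm `‖V x‖`, multiplying by `h * g` becomes part of the geometry.
  obtain ⟨V, hV⟩ := exists_equiv_norm_sq_eq hG hc hcoer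
  refine ⟨_, ⟨V, rfl⟩, ?_⟩
  obtain ⟨B, hB, hBform⟩ := (ha.conj V).exists_hasHereditarySumSOT
  refine ⟨B, by rwa [funext (taylorCoeff_eq_coeff hαR)], ?_⟩
  have hform : ∀ y, 0 ≤ hereditaryForm a
      ((V : H →L[ℂ] H) ∘L That ∘L (V.symm : H →L[ℂ] H)) y := by
    intro y
    obtain ⟨x, rfl⟩ := V.surjective y
    have h1 : hereditaryForm a ((V : H →L[ℂ] H) ∘L That ∘L (V.symm : H →L[ℂ] H)) (V x) =
        hereditaryForm (a * (h * g)) That x := by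
      refine HasSum.tsum_eq ((ha.hasSum_hereditaryForm_mul (hh.mul hg) x).congr_fun fun n => ?_)
      rw [conj_pow_apply, hV]
    -- Regrouping `a(hg) = h(ag)` brings in the hypothesis on `γ`, whose series is `ag`.
    rw [h1, mul_left_comm]
    exact hereditaryForm_mul_nonneg hh (ha.mul hg) h0 hag x
  rw [ContinuousLinearMap.isPositive_iff_complex]
  intro y
  have h1 : inner ℂ (B y) y = ((hereditaryForm a
      ((V : H →L[ℂ] H) ∘L That ∘L (V.symm : H →L[ℂ] H)) y : ℝ) : ℂ) := by
    rw [← inner_conj_symm, hBform, Complex.conj_ofReal]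
  rw [h1]
  simp [hform y]
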